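/- **Model.** $N$ mobile devices share a bandwidth $w>0$ with noise density $N_0>0$; slots have length $\tau>0$; $\kappa>0$. Device $i$ needs $L_i>0$ CPU cycles per bit and has maximal CPU frequency $f_{i,\max}\ge 0$ and maximal transmit power $p_{i,\max}\ge 0$. In slot $t=0,1,2,\dots$, $A_i(t)\in[A_{i,\min},A_{i,\max}]$ bits arrive ($A_{i,\min}\ge0$), and the channel power gain is $H_i(t)=h_i(t)g_0(d_0/d_i)^{\theta}$ ($g_0,d_0,d_i>0$), where $h_i(t)\ge 0$ has finite mean; the vectors $(A(t),h(t))$ are i.i.d. over $t$. A decision in slot $t$ consists of $f(t),p(t),\alpha(t)\in\mathbb R^N$ with $$0\le f_i(t)\le f_{i,\max},\qquad 0\le p_i(t)\le p_{i,\max},\qquad \alpha_i(t)\ge\epsilon_A,\qquad \sum_i\alpha_i(t)\le 1,$$ where $\epsilon_A\in(0,1/N)$ is fixed. It has power $P(t)=\sum_i\big(p_i(t)+\kappa f_i(t)^3\big)$ and departures $$D_i(t)=\frac{\tau f_i(t)}{L_i}+\alpha_i(t)w\tau\log_2\Big(1+\frac{H_i(t)p_i(t)}{\alpha_i(t)N_0w}\Big).$$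 The queues are $Q_i(0)=0$, $Q_i(t+1)=\max\{Q_i(t)-D_i(t),0\}+A_i(t)$. The queue $Q_i$ is mean rate stable if $\mathbb E|Q_i(t)|/t\to0$. Write $\overline P=\limsup_{T\to\infty}\frac1T\mathbb E\sum_{t<T}P(t)$ and $\overline{Q}_{\Sigma}=\limsup_{T\to\infty}\frac1T\mathbb E\sum_{t<T}\sum_iQ_i(t)$. Decisions are causal: the decision of slot $t$ is measurable with respect to $\mathcal G_t$, where $(\mathcal G_t)$ is a filtration such that $(A(t),h(t))$ is $\mathcal G_t$-measurable and $(A(t+1),h(t+1))$ is independent of $\mathcal G_t$. The problem $\mathbf P_2$ is to minimise $\overline P$ over causal decisions that satisfy the constraints above and make every queue mean rate stable; $P^{\rm opt}$ is its optimal value (infimum). For $V>0$, the per-slot drift-plus-penalty policy with parameter $V$ takes in every slot a causal decision that minimises $-\sum_iQ_i(t)D_i(t)+V\,P(t)$ over all decisions satisfying the constraints above. Let $$C=\tfrac12\sum_i\Big(\mathbb E[A_i(0)^2]+\mathbb E\Big[\Big(\tfrac{\tau f_{i,\max}}{L_i}+w\tau\log_2\big(1+\tfrac{H_i(0)p_{i,\max}}{N_0w}\big)\Big)^2\Big]\Big).$$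 The Slater conditions hold with slack $\epsilon>0$ and power level $\Psi$ if some stationary randomised policy, whose decision in a slot satisfies the constraints and is drawn from a distribution depending only on $(A(t),h(t))$, has $\mathbb E[P(t)]=\Psi$ and $\mathbb E[D_i(t)]\ge\mathbb E[A_i(t)]+\epsilon$ for all $i$. **Theorem 1.** Assume that $\mathbf P_2$ is feasible. For every $V>0$ and every run of the drift-plus-penalty policy with parameter $V$: 1. $\overline P\le P^{\rm opt}+C/V$; 2. every queue $Q_i$ is mean rate stable; 3. if the Slater conditions hold with slack $\epsilon>0$ and power level $\Psi$, then $\overline{Q}_{\Sigma}\le\big[C+V(\Psi-P^{\rm opt})\big]/\epsilon$. Consequently, if the Slater conditions hold for some $\epsilon>0$ and $\Psi$, there is a constant $K$ such that for all $V\ge1$ every such run has $P^{\rm opt}\le\overline P\le P^{\rm opt}+K/V$ and $\overline{Q}_{\Sigma}\le KV$: an $[O(1/V),O(V)]$ power–delay tradeoff. -/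

import Mathlib

open MeasureTheory ProbabilityTheory Filter Topology

namespace MEC

/-- Parameters of a mobile-edge computing system with `N` mobile devices sharing one server. -/
structure System (N : ℕ) where
  /-- bandwidth -/
  w : ℝ
  /-- noise power spectral density -/
  N0 : ℝ
  /-- slot length -/
  τ : ℝ
  /-- effective switched capacitance of the CPUs -/
  κ : ℝ
  /-- path-loss constant -/
  g0 : ℝ
  /-- reference distance -/
  d0 : ℝ
  /-- path-loss exponent -/
  θ : ℝ
  /-- distance of each device from the server -/
  d : Fin N → ℝ
  /-- CPU cycles per bit -/
  L : Fin N → ℝ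
  /-- maximal CPU frequency -/
  fmax : Fin N → ℝ
  /-- maximal transmit power -/
  pmax : Fin N → ℝ
  /-- least number of bits that arrive in a slot -/
  Amin : Fin N → ℝ
  /-- largest number of bits that arrive in a slot -/
  Amax : Fin N → ℝ
  /-- lower bound of the bandwidth fractions -/
  εA : ℝ
  w_pos : 0 < w
  N0_pos : 0 < N0
  τ_pos : 0 < τ
  κ_pos : 0 < κ
  g0_pos : 0 < g0
  d0_pos : 0 < d0
  d_pos : ∀ i, 0 < d i
  L_pos : ∀ i, 0 < L i
  fmax_nonneg : ∀ i, 0 ≤ fmax i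
  pmax_nonneg : ∀ i, 0 ≤ pmax i
  Amin_nonneg : ∀ i, 0 ≤ Amin i
  εA_pos : 0 < εA
  εA_lt : εA < 1 / (N : ℝ)

/-- The random state of one slot: arriving bits `A` and small-scale fading power gains `h`. -/
abbrev State (N : ℕ) := (Fin N → ℝ) × (Fin N → ℝ)

/-- Arriving bits. -/
abbrev State.A {N : ℕ} (s : State N) : Fin N → ℝ := s.1

/-- Small-scale fading power gains. -/
abbrev State.h {N : ℕ} (s : State N) : Fin N → ℝ := s.2

/-- The decision of one slot: CPU frequencies, transmit powers, bandwidth fractions. -/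
abbrev Action (N : ℕ) := (Fin N → ℝ) × (Fin N → ℝ) × (Fin N → ℝ)

/-- CPU frequencies. -/
abbrev Action.f {N : ℕ} (a : Action N) : Fin N → ℝ := a.1

/-- Transmit powers. -/
abbrev Action.p {N : ℕ} (a : Action N) : Fin N → ℝ := a.2.1

/-- Bandwidth fractions. -/
abbrev Action.α {N : ℕ} (a : Action N) : Fin N → ℝ := a.2.2

noncomputable section

variable {N : ℕ}

namespace System

/-- Channel power gain for the fading gain `h` of device `i`. -/
def gain (S : System N) (i : Fin N) (h : ℝ) : ℝ :=
  h * S.g0 * (S.d0 / S.d i) ^ S.θ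

/-- Bits executed by the local CPU in one slot. -/
def dLocal (S : System N) (a : Action N) (i : Fin N) : ℝ :=
  S.τ * Action.f a i * (S.L i)⁻¹

/-- Bits offloaded to the server in one slot. -/
def dRemote (S : System N) (h : Fin N → ℝ) (a : Action N) (i : Fin N) : ℝ :=
  if 0 < Action.α a i then
    Action.α a i * S.w * S.τ *
      Real.logb 2 (1 + S.gain i (h i) * Action.p a i / (Action.α a i * S.N0 * S.w))
  else 0

/-- Total bits departing in one slot. -/
def departure (S : System N) (h : Fin N → ℝ) (a : Action N) (i : Fin N) : ℝ :=
  S.dLocal a i + S.dRemote h a i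

/-- Total power of the devices in one slot. -/
def power (S : System N) (a : Action N) : ℝ :=
  ∑ i, (Action.p a i + S.κ * Action.f a i ^ 3)

/-- The per-slot decisions allowed, with bandwidth fractions at least `εA`. -/
def feasible (S : System N) : Set (Action N) :=
  {a | (∀ i, 0 ≤ Action.f a i ∧ Action.f a i ≤ S.fmax i) ∧
    (∀ i, 0 ≤ Action.p a i ∧ Action.p a i ≤ S.pmax i) ∧
    (∀ i, S.εA ≤ Action.α a i) ∧ ∑ i, Action.α a i ≤ 1}

/-- The objective of the per-slot problem for queue lengths `q`, fading gains `h` and weight `V`. -/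
def perSlotObjective (S : System N) (V : ℝ) (q h : Fin N → ℝ) (a : Action N) : ℝ :=
  -(∑ i, q i * S.departure h a i) + V * S.power a

/-- The assumptions on the law of the state of a slot: bounded arrivals, and nonnegative fading
gains with finite mean. The arrivals and gains of one slot may be dependent on each other. -/
structure IsStateLaw (S : System N) (ν : Measure (State N)) : Prop where
  isProbabilityMeasure : IsProbabilityMeasure ν
  arrival_mem : ∀ i, ∀ᵐ s ∂ν, State.A s i ∈ Set.Icc (S.Amin i) (S.Amax i)
  fading_nonneg : ∀ i, ∀ᵐ s ∂ν, 0 ≤ State.h s i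
  fading_integrable : ∀ i, Integrable (fun s => State.h s i) ν

/-- Departures of device `i` at full CPU frequency, full transmit power and with the whole
bandwidth: the largest possible departure for fading gain `h`. -/
def maxDeparture (S : System N) (h : ℝ) (i : Fin N) : ℝ :=
  S.τ * S.fmax i * (S.L i)⁻¹ +
    S.w * S.τ * Real.logb 2 (1 + S.gain i h * S.pmax i / (S.N0 * S.w))

/-- The constant `C` of the one-slot drift bound: half the sum of the second moments of the
arrivals and of the largest possible departures. It depends only on the system and on the law of
the state of a slot. -/
def driftConst (S : System N) (ν : Measure (State N)) : ℝ :=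
  (1 / 2) * ∑ i, ((∫ s, State.A s i ^ 2 ∂ν) + ∫ s, S.maxDeparture (State.h s i) i ^ 2 ∂ν)

/-- Slater conditions with slack `ε` and power `Ψ`: a stationary randomized policy, which draws the
decision of a slot from a distribution depending only on the state of that slot, has mean power `Ψ`
and serves every device at mean rate at least its mean arrival rate plus `ε`. -/
def Slater (S : System N) (ν : Measure (State N)) (ε Ψ : ℝ) : Prop :=
  ∃ K : Kernel (State N) (Action N), IsMarkovKernel K ∧
    (∀ᵐ s ∂ν, ∀ᵐ a ∂(K s), a ∈ S.feasible) ∧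
    (∫ s, ∫ a, S.power a ∂(K s) ∂ν) = Ψ ∧
    ∀ i, (∫ s, State.A s i ∂ν) + ε ≤ ∫ s, ∫ a, S.departure (State.h s) a i ∂(K s) ∂ν

variable {Ω : Type*} [m : MeasurableSpace Ω]

/-- Queue lengths driven by the states `s` and the decisions `x`, started at zero. -/
def queue (S : System N) (s : ℕ → Ω → State N) (x : ℕ → Ω → Action N) :
    ℕ → Ω → Fin N → ℝ
  | 0 => fun _ _ => 0
  | t + 1 => fun ω i =>
      max (queue S s x t ω i - S.departure (State.h (s t ω)) (x t ω) i) 0 + State.A (s t ω) i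

/-- Mean rate stability of the queue of device `i`. -/
def MeanRateStable (S : System N) (μ : Measure Ω) (s : ℕ → Ω → State N)
    (x : ℕ → Ω → Action N) (i : Fin N) : Prop :=
  Tendsto (fun t : ℕ => (∫ ω, |S.queue s x t ω i| ∂μ) / (t : ℝ)) atTop (𝓝 0)

/-- Long-run average power (upper limit; the averages are bounded for feasible decisions). -/
def avgPower (S : System N) (μ : Measure Ω) (x : ℕ → Ω → Action N) : ℝ :=
  limsup (fun T : ℕ => (1 / (T : ℝ)) * ∫ ω, ∑ t ∈ Finset.range T, S.power (x t ω) ∂μ) atTop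

/-- Long-run average of the sum of the queue lengths (upper limit, possibly infinite). -/
def avgSumQueue (S : System N) (μ : Measure Ω) (s : ℕ → Ω → State N)
    (x : ℕ → Ω → Action N) : EReal :=
  limsup (fun T : ℕ =>
    (((1 / (T : ℝ)) * ∫ ω, ∑ t ∈ Finset.range T, ∑ i, S.queue s x t ω i ∂μ : ℝ) : EReal)) atTop

/-- `s` is an i.i.d. sequence of states with law `ν`, and `𝒢 t` is the information available when
the decision of slot `t` is taken: it contains the state of slot `t` and, by monotonicity, the
earlier ones, possibly also extra randomness, but it is independent of the next state. -/
structure IsStateProcess (μ : Measure Ω) (ν : Measure (State N)) (𝒢 : Filtration ℕ m)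
    (s : ℕ → Ω → State N) : Prop where
  adapted : ∀ t, Measurable[𝒢 t] (s t)
  law : ∀ t, μ.map (s t) = ν
  indep : ∀ t, Indep (MeasurableSpace.comap (s (t + 1)) inferInstance) (𝒢 t) μ

/-- Causal decisions that satisfy the per-slot constraints. -/
structure IsPolicy (S : System N) (μ : Measure Ω) (𝒢 : Filtration ℕ m)
    (x : ℕ → Ω → Action N) : Prop where
  adapted : ∀ t, Measurable[𝒢 t] (x t)
  mem : ∀ t, ∀ᵐ ω ∂μ, x t ω ∈ S.feasible

/-- The feasible points of the power minimization problem: causal decisions that satisfy the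
per-slot constraints and keep every queue mean rate stable. -/
structure IsFeasiblePolicy (S : System N) (μ : Measure Ω) (𝒢 : Filtration ℕ m)
    (s : ℕ → Ω → State N) (x : ℕ → Ω → Action N) : Prop extends S.IsPolicy μ 𝒢 x where
  stable : ∀ i, S.MeanRateStable μ s x i

/-- The optimal value of the power minimization problem. -/
def optPower (S : System N) (μ : Measure Ω) (𝒢 : Filtration ℕ m) (s : ℕ → Ω → State N) : ℝ :=
  sInf {P | ∃ x, S.IsFeasiblePolicy μ 𝒢 s x ∧ P = S.avgPower μ x}

/-- A run of the online algorithm with parameter `V`: in every slot the decision minimizes the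
per-slot objective at the current queue lengths and fading gains over all allowed decisions.
Ties may be broken in any causal way. -/
structure IsOnlineRun (S : System N) (V : ℝ) (μ : Measure Ω) (𝒢 : Filtration ℕ m)
    (s : ℕ → Ω → State N) (x : ℕ → Ω → Action N) : Prop extends S.IsPolicy μ 𝒢 x where
  isMinOn : ∀ t, ∀ᵐ ω ∂μ,
    IsMinOn (S.perSlotObjective V (S.queue s x t ω) (State.h (s t ω))) S.feasible (x t ω)

end System

end

end MEC

/-!
The proof is Lyapunov optimization with the quadratic function `½ ∑ᵢ Qᵢ²`, whose expected growth in
one slot is at most `C + ∑ᵢ 𝔼[Qᵢ (Aᵢ - Dᵢ)]` (`integral_sq_queue_succ_le`). The online algorithm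
minimizes the decision-dependent part of this bound plus `V` times the power, so in every slot it
can be compared with any stationary policy, whose departures are independent of the current queue
lengths (`IsOnlineRun.drift_le`).

The comparison with arbitrary causal policies goes through `attainable`, the set of pairs of mean
departures and mean power that stationary policies dominate. Departures are concave and power is
convex in the decision, the former because `α log (1 + c p / α)` is the perspective of a concave
function. Hence `attainable` is convex, and by Jensen's inequality it contains the means of every
randomized stationary policy (`mem_attainable_of_kernel`), so also the one-slot means of every
causal policy, by disintegration over the state (`mem_attainable_of_policy`), and their time
averages. If a policy keeps the queues mean rate stable, these averages serve the mean arrivals up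
to an error that vanishes as `T → ∞` (`average_mem_attainable`). Comparing one fixed slot of the
online run with these averages and letting `T → ∞` bounds the drift plus `V` times the power by
`C + V P̄` (`IsOnlineRun.drift_le_avgPower`); summing over the slots yields the power bound, and
linear growth of the second moments, which gives mean rate stability.

Comparison with the Slater policy keeps `ε ∑ᵢ 𝔼 Qᵢ` on the left. Turning this into the queue bound
requires the optimal value to bound the lower limit, not just the upper limit, of the average
power. This is `eventually_optPower_sub_le`: the averages up to a late slot, mixed with a little of
the Slater policy, are attainable and serve all arrivals, and such pairs are realized by stationary
policies that keep the queues mean rate stable (`optPower_le_of_mem_attainable`).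
-/

namespace MEC

variable {N : ℕ}

namespace System

/-! ### The perspective of the logarithm -/

/-- Joint concavity of the rate `α log (1 + c p / α)` in power and bandwidth, as the perspective of
the concave function `log (1 + c p)`. -/
theorem perspective_log_concave {c p₁ p₂ α₁ α₂ a b : ℝ} (hc : 0 ≤ c) (hp₁ : 0 ≤ p₁)
    (hp₂ : 0 ≤ p₂) (hα₁ : 0 < α₁) (hα₂ : 0 < α₂) (ha : 0 ≤ a) (hb : 0 ≤ b) (hab : a + b = 1) :
    a * (α₁ * Real.log (1 + c * p₁ / α₁)) + b * (α₂ * Real.log (1 + c * p₂ / α₂)) ≤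
      (a * α₁ + b * α₂) * Real.log (1 + c * (a * p₁ + b * p₂) / (a * α₁ + b * α₂)) := by
  have hα : 0 < a * α₁ + b * α₂ := by
    rcases ha.eq_or_lt with rfl | ha'
    · have : b = 1 := by linarith
      subst this; linarith
    · have := mul_pos ha' hα₁
      have := mul_nonneg hb hα₂.le
      linarith
  have h₁ : (1 + c * p₁ / α₁) ∈ Set.Ioi (0 : ℝ) := by
    have : 0 ≤ c * p₁ / α₁ := by positivity
    exact Set.mem_Ioi.2 (by linarith)
  have h₂ : (1 + c * p₂ / α₂) ∈ Set.Ioi (0 : ℝ) := by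
    have : 0 ≤ c * p₂ / α₂ := by positivity
    exact Set.mem_Ioi.2 (by linarith)
  have hw₁ : 0 ≤ a * α₁ / (a * α₁ + b * α₂) := by positivity
  have hw₂ : 0 ≤ b * α₂ / (a * α₁ + b * α₂) := by positivity
  have h := strictConcaveOn_log_Ioi.concaveOn.2 h₁ h₂ hw₁ hw₂ (by field_simp)
  simp only [smul_eq_mul] at h
  have e : a * α₁ / (a * α₁ + b * α₂) * (1 + c * p₁ / α₁) +
      b * α₂ / (a * α₁ + b * α₂) * (1 + c * p₂ / α₂) =
      1 + c * (a * p₁ + b * p₂) / (a * α₁ + b * α₂) := by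
    field_simp
    ring
  rw [e] at h
  have h' := mul_le_mul_of_nonneg_left h hα.le
  refine le_trans (le_of_eq ?_) h'
  field_simp

/-- A device gains from receiving the whole bandwidth: this is concavity of the logarithm between
`1` and `1 + x / α`. -/
theorem mul_log_one_add_div_le {x α : ℝ} (hx : 0 ≤ x) (hα : 0 < α) (hα1 : α ≤ 1) :
    α * Real.log (1 + x / α) ≤ Real.log (1 + x) := by
  have h₁ : (1 + x / α) ∈ Set.Ioi (0 : ℝ) := by
    have : 0 ≤ x / α := by positivity
    exact Set.mem_Ioi.2 (by linarith)
  have h := strictConcaveOn_log_Ioi.concaveOn.2 h₁ (Set.mem_Ioi.2 one_pos) hα.le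
    (sub_nonneg.2 hα1) (by ring)
  simp only [smul_eq_mul, Real.log_one, mul_zero, add_zero] at h
  have e : α * (1 + x / α) + (1 - α) * 1 = 1 + x := by field_simp; ring
  rwa [e] at h

/-- The logarithm grows at most like a square root. -/
theorem sq_log_one_add_le {x : ℝ} (hx : 0 ≤ x) : Real.log (1 + x) ^ 2 ≤ 4 * (1 + x) := by
  have h0 : 0 ≤ Real.log (1 + x) := Real.log_nonneg (by linarith)
  have hs : 0 < √(1 + x) := Real.sqrt_pos.2 (by linarith)
  have h1 : Real.log (1 + x) ≤ 2 * √(1 + x) := by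
    have := Real.log_le_sub_one_of_pos hs
    rw [Real.log_sqrt (by linarith)] at this
    linarith
  calc Real.log (1 + x) ^ 2 ≤ (2 * √(1 + x)) ^ 2 := by gcongr
    _ = 4 * (1 + x) := by rw [mul_pow, Real.sq_sqrt (by linarith)]; norm_num

/-! ### Decisions of one slot -/

section Decision

variable (S : System N)

theorem gain_nonneg (i : Fin N) {h : ℝ} (hh : 0 ≤ h) : 0 ≤ S.gain i h := by
  have := S.d0_pos
  have := S.d_pos i
  have := S.g0_pos
  unfold gain
  positivity

theorem bandwidth_pos {a : Action N} (ha : a ∈ S.feasible) (i : Fin N) : 0 < Action.α a i :=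
  S.εA_pos.trans_le (ha.2.2.1 i)

theorem bandwidth_le_one {a : Action N} (ha : a ∈ S.feasible) (i : Fin N) : Action.α a i ≤ 1 :=
  (Finset.single_le_sum (fun j _ => (S.bandwidth_pos ha j).le) (Finset.mem_univ i)).trans ha.2.2.2

/-- On allowed decisions the departures are a linear function plus the perspective of a
logarithm. -/
theorem departure_eq {a : Action N} (ha : a ∈ S.feasible) (h : Fin N → ℝ) (i : Fin N) :
    S.departure h a i = S.τ * Action.f a i * (S.L i)⁻¹ + S.w * S.τ / Real.log 2 *
      (Action.α a i *
        Real.log (1 + S.gain i (h i) / (S.N0 * S.w) * Action.p a i / Action.α a i)) := by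
  have hα := S.bandwidth_pos ha i
  have hN := S.N0_pos
  have hw := S.w_pos
  have e : S.gain i (h i) * Action.p a i / (Action.α a i * S.N0 * S.w) =
      S.gain i (h i) / (S.N0 * S.w) * Action.p a i / Action.α a i := by field_simp
  rw [departure, dLocal, dRemote, if_pos hα, e, Real.logb]
  ring

theorem isClosed_feasible : IsClosed S.feasible := by
  have hf : ∀ i, Continuous fun a : Action N => Action.f a i := fun i => by
    unfold Action.f; fun_prop
  have hp : ∀ i, Continuous fun a : Action N => Action.p a i := fun i => by
    unfold Action.p; fun_prop
  have hα : ∀ i, Continuous fun a : Action N => Action.α a i := fun i => by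
    unfold Action.α; fun_prop
  simp only [feasible, Set.ofPred_and, Set.ofPred_forall]
  refine IsClosed.inter (isClosed_iInter fun i => ?_) (IsClosed.inter (isClosed_iInter fun i => ?_)
    (IsClosed.inter (isClosed_iInter fun i => ?_) ?_))
  · exact (isClosed_le continuous_const (hf i)).inter (isClosed_le (hf i) continuous_const)
  · exact (isClosed_le continuous_const (hp i)).inter (isClosed_le (hp i) continuous_const)
  · exact isClosed_le continuous_const (hα i)
  · exact isClosed_le (continuous_finsetSum _ fun i _ => hα i) continuous_const

theorem convex_feasible : Convex ℝ S.feasible := by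
  intro x hx y hy a b ha hb hab
  obtain ⟨hx1, hx2, hx3, hx4⟩ := hx
  obtain ⟨hy1, hy2, hy3, hy4⟩ := hy
  have hb' : b = 1 - a := by linarith
  refine ⟨fun i => ⟨?_, ?_⟩, fun i => ⟨?_, ?_⟩, fun i => ?_, ?_⟩
  · exact add_nonneg (mul_nonneg ha (hx1 i).1) (mul_nonneg hb (hy1 i).1)
  · calc a * Action.f x i + b * Action.f y i ≤ a * S.fmax i + b * S.fmax i :=
        add_le_add (mul_le_mul_of_nonneg_left (hx1 i).2 ha)
          (mul_le_mul_of_nonneg_left (hy1 i).2 hb)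
      _ = S.fmax i := by rw [hb']; ring
  · exact add_nonneg (mul_nonneg ha (hx2 i).1) (mul_nonneg hb (hy2 i).1)
  · calc a * Action.p x i + b * Action.p y i ≤ a * S.pmax i + b * S.pmax i :=
        add_le_add (mul_le_mul_of_nonneg_left (hx2 i).2 ha)
          (mul_le_mul_of_nonneg_left (hy2 i).2 hb)
      _ = S.pmax i := by rw [hb']; ring
  · calc S.εA = a * S.εA + b * S.εA := by rw [hb']; ring
      _ ≤ a * Action.α x i + b * Action.α y i :=
        add_le_add (mul_le_mul_of_nonneg_left (hx3 i) ha) (mul_le_mul_of_nonneg_left (hy3 i) hb)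
  · calc ∑ i, (a * Action.α x i + b * Action.α y i)
        = a * ∑ i, Action.α x i + b * ∑ i, Action.α y i := by
          rw [Finset.sum_add_distrib, Finset.mul_sum, Finset.mul_sum]
      _ ≤ a * 1 + b * 1 := add_le_add (mul_le_mul_of_nonneg_left hx4 ha)
          (mul_le_mul_of_nonneg_left hy4 hb)
      _ = 1 := by rw [hb']; ring

theorem exists_norm_le_of_mem_feasible : ∃ B : ℝ, ∀ a ∈ S.feasible, ‖a‖ ≤ B := by
  refine ⟨∑ i, S.fmax i + (∑ i, S.pmax i + 1), fun a ha => ?_⟩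
  have hF : 0 ≤ ∑ i, S.fmax i := Finset.sum_nonneg fun i _ => S.fmax_nonneg i
  have hP : 0 ≤ ∑ i, S.pmax i := Finset.sum_nonneg fun i _ => S.pmax_nonneg i
  have h1 : ‖a.1‖ ≤ ∑ i, S.fmax i := (pi_norm_le_iff_of_nonneg hF).2 fun i => by
    rw [Real.norm_of_nonneg (ha.1 i).1]
    exact (ha.1 i).2.trans
      (Finset.single_le_sum (fun j _ => S.fmax_nonneg j) (Finset.mem_univ i))
  have h2 : ‖a.2.1‖ ≤ ∑ i, S.pmax i := (pi_norm_le_iff_of_nonneg hP).2 fun i => by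
    rw [Real.norm_of_nonneg (ha.2.1 i).1]
    exact (ha.2.1 i).2.trans
      (Finset.single_le_sum (fun j _ => S.pmax_nonneg j) (Finset.mem_univ i))
  have h3 : ‖a.2.2‖ ≤ 1 := (pi_norm_le_iff_of_nonneg zero_le_one).2 fun i => by
    rw [Real.norm_of_nonneg (S.bandwidth_pos ha i).le]
    exact S.bandwidth_le_one ha i
  rw [Prod.norm_def, Prod.norm_def]
  refine max_le ?_ (max_le ?_ ?_) <;> linarith

theorem power_nonneg {a : Action N} (ha : a ∈ S.feasible) : 0 ≤ S.power a :=
  Finset.sum_nonneg fun i _ => add_nonneg (ha.2.1 i).1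
    (mul_nonneg S.κ_pos.le (pow_nonneg (ha.1 i).1 3))

theorem power_le {a : Action N} (ha : a ∈ S.feasible) :
    S.power a ≤ ∑ i, (S.pmax i + S.κ * S.fmax i ^ 3) :=
  Finset.sum_le_sum fun i _ => add_le_add (ha.2.1 i).2
    (mul_le_mul_of_nonneg_left (pow_le_pow_left₀ (ha.1 i).1 (ha.1 i).2 3) S.κ_pos.le)

theorem continuous_power : Continuous S.power := by
  unfold power Action.p Action.f
  fun_prop

theorem convexOn_power : ConvexOn ℝ S.feasible S.power := by
  refine ⟨S.convex_feasible, fun x hx y hy a b ha hb hab => ?_⟩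
  simp only [power, smul_eq_mul, Finset.mul_sum, ← Finset.sum_add_distrib]
  refine Finset.sum_le_sum fun i _ => ?_
  have h := (convexOn_pow 3).2 (Set.mem_Ici.2 (hx.1 i).1) (Set.mem_Ici.2 (hy.1 i).1) ha hb hab
  simp only [smul_eq_mul] at h
  have h' := mul_le_mul_of_nonneg_left h S.κ_pos.le
  change a * Action.p x i + b * Action.p y i +
    S.κ * (a * Action.f x i + b * Action.f y i) ^ 3 ≤ _
  linarith

theorem rate_const_nonneg : 0 ≤ S.w * S.τ / Real.log 2 :=
  div_nonneg (mul_nonneg S.w_pos.le S.τ_pos.le) (Real.log_nonneg one_le_two)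

variable {h : Fin N → ℝ}

theorem departure_nonneg {a : Action N} (ha : a ∈ S.feasible) {i : Fin N} (hh : 0 ≤ h i) :
    0 ≤ S.departure h a i := by
  rw [S.departure_eq ha]
  have hg := S.gain_nonneg i hh
  have hp := (ha.2.1 i).1
  have hα := S.bandwidth_pos ha i
  have hN := S.N0_pos
  have hw := S.w_pos
  refine add_nonneg (mul_nonneg (mul_nonneg S.τ_pos.le (ha.1 i).1) (inv_nonneg.2 (S.L_pos i).le))
    (mul_nonneg S.rate_const_nonneg (mul_nonneg hα.le (Real.log_nonneg ?_)))
  have : 0 ≤ S.gain i (h i) / (S.N0 * S.w) * Action.p a i / Action.α a i := by positivity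
  linarith

theorem departure_le_maxDeparture {a : Action N} (ha : a ∈ S.feasible) {i : Fin N}
    (hh : 0 ≤ h i) : S.departure h a i ≤ S.maxDeparture (h i) i := by
  rw [S.departure_eq ha, maxDeparture, Real.logb]
  have hg := S.gain_nonneg i hh
  have hp := (ha.2.1 i).1
  have hα := S.bandwidth_pos ha i
  have hN := S.N0_pos
  have hw := S.w_pos
  have hx : 0 ≤ S.gain i (h i) / (S.N0 * S.w) * Action.p a i := by positivity
  have h1 : Action.α a i *
      Real.log (1 + S.gain i (h i) / (S.N0 * S.w) * Action.p a i / Action.α a i) ≤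
      Real.log (1 + S.gain i (h i) * S.pmax i / (S.N0 * S.w)) := by
    refine (mul_log_one_add_div_le hx hα (S.bandwidth_le_one ha i)).trans
      (Real.log_le_log (by linarith) ?_)
    rw [mul_div_right_comm]
    gcongr
    exact (ha.2.1 i).2
  have h2 := mul_le_mul_of_nonneg_left h1 S.rate_const_nonneg
  have h3 : S.τ * Action.f a i * (S.L i)⁻¹ ≤ S.τ * S.fmax i * (S.L i)⁻¹ :=
    mul_le_mul_of_nonneg_right (mul_le_mul_of_nonneg_left (ha.1 i).2 S.τ_pos.le)
      (inv_nonneg.2 (S.L_pos i).le)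
  refine (add_le_add h3 h2).trans (le_of_eq ?_)
  ring

theorem continuousOn_departure {i : Fin N} (hh : 0 ≤ h i) :
    ContinuousOn (fun a => S.departure h a i) S.feasible := by
  refine ContinuousOn.congr ?_ fun a ha => S.departure_eq ha h i
  unfold Action.f Action.α Action.p
  refine ContinuousOn.add (by fun_prop) (ContinuousOn.mul (by fun_prop)
    (ContinuousOn.mul (by fun_prop) (ContinuousOn.log (ContinuousOn.add (by fun_prop)
      (ContinuousOn.div (by fun_prop) (by fun_prop) fun a ha => (S.bandwidth_pos ha i).ne'))
      fun a ha => ?_)))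
  have hg := S.gain_nonneg i hh
  have hp : 0 ≤ a.2.1 i := (ha.2.1 i).1
  have hα : 0 < a.2.2 i := S.bandwidth_pos ha i
  have hN := S.N0_pos
  have hw := S.w_pos
  have : 0 ≤ S.gain i (h i) / (S.N0 * S.w) * a.2.1 i / a.2.2 i := by positivity
  linarith

theorem concaveOn_departure {i : Fin N} (hh : 0 ≤ h i) :
    ConcaveOn ℝ S.feasible fun a => S.departure h a i := by
  refine ⟨S.convex_feasible, fun x hx y hy a b ha hb hab => ?_⟩
  simp only [smul_eq_mul]
  rw [S.departure_eq hx, S.departure_eq hy,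
    S.departure_eq (S.convex_feasible hx hy ha hb hab)]
  have hc : 0 ≤ S.gain i (h i) / (S.N0 * S.w) :=
    div_nonneg (S.gain_nonneg i hh) (mul_pos S.N0_pos S.w_pos).le
  have hlog := mul_le_mul_of_nonneg_left
    (perspective_log_concave hc (hx.2.1 i).1 (hy.2.1 i).1 (S.bandwidth_pos hx i)
      (S.bandwidth_pos hy i) ha hb hab) S.rate_const_nonneg
  change _ ≤ S.τ * (a * Action.f x i + b * Action.f y i) * (S.L i)⁻¹ + S.w * S.τ / Real.log 2 *
    ((a * Action.α x i + b * Action.α y i) * Real.log (1 + S.gain i (h i) / (S.N0 * S.w) *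
      (a * Action.p x i + b * Action.p y i) / (a * Action.α x i + b * Action.α y i)))
  linarith

theorem measurable_departure (i : Fin N) :
    Measurable fun z : State N × Action N => S.departure (State.h z.1) z.2 i := by
  unfold departure dLocal dRemote gain State.h Action.f Action.α Action.p Real.logb
  refine Measurable.add (by fun_prop)
    (Measurable.ite (measurableSet_lt (by fun_prop) (by fun_prop)) (by fun_prop) (by fun_prop))

theorem measurable_maxDeparture (i : Fin N) :
    Measurable fun s : State N => S.maxDeparture (State.h s i) i := by
  unfold maxDeparture gain State.h Real.logb
  fun_prop

theorem maxDeparture_nonneg {h : ℝ} (hh : 0 ≤ h) (i : Fin N) : 0 ≤ S.maxDeparture h i := by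
  have hg := S.gain_nonneg i hh
  have hp := S.pmax_nonneg i
  have hf := S.fmax_nonneg i
  have hL := S.L_pos i
  have hN := S.N0_pos
  have hw := S.w_pos
  have ht := S.τ_pos
  have : 0 ≤ S.gain i h * S.pmax i / (S.N0 * S.w) := by positivity
  have := Real.logb_nonneg one_lt_two (x := 1 + S.gain i h * S.pmax i / (S.N0 * S.w))
    (by linarith)
  unfold maxDeparture
  positivity

/-- The largest departure has a second moment as soon as the fading gain has a mean, because the
squared logarithm grows at most linearly. -/
theorem memLp_maxDeparture {ν : Measure (State N)} (hν : S.IsStateLaw ν) (i : Fin N) :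
    MemLp (fun s : State N => S.maxDeparture (State.h s i) i) 2 ν := by
  have := hν.isProbabilityMeasure
  have hN := S.N0_pos
  have hw := S.w_pos
  have hp := S.pmax_nonneg i
  have hint : Integrable (fun s : State N =>
      4 * (1 + S.gain i (State.h s i) * S.pmax i / (S.N0 * S.w))) ν := by
    unfold gain
    exact ((integrable_const 1).add
      (((((hν.fading_integrable i).mul_const _).mul_const _).mul_const _).div_const _)).const_mul 4
  have hlog : MemLp (fun s : State N =>
      Real.log (1 + S.gain i (State.h s i) * S.pmax i / (S.N0 * S.w))) 2 ν := by
    have hm : AEStronglyMeasurable (fun s : State N =>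
        Real.log (1 + S.gain i (State.h s i) * S.pmax i / (S.N0 * S.w))) ν := by
      unfold gain State.h
      exact Measurable.aestronglyMeasurable (by fun_prop)
    refine (memLp_two_iff_integrable_sq hm).2 (hint.mono' (hm.pow 2) ?_)
    filter_upwards [hν.fading_nonneg i] with s hs
    have hg := S.gain_nonneg i hs
    rw [Real.norm_of_nonneg (sq_nonneg _)]
    exact sq_log_one_add_le (by positivity)
  have h := (memLp_const (μ := ν) (p := 2) (S.τ * S.fmax i * (S.L i)⁻¹)).add
    (hlog.const_mul (S.w * S.τ / Real.log 2))
  refine h.ae_eq (Eventually.of_forall fun s => ?_)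
  simp only [Pi.add_apply, maxDeparture, Real.logb]
  ring

theorem memLp_arrival {ν : Measure (State N)} (hν : S.IsStateLaw ν) (i : Fin N) :
    MemLp (fun s : State N => State.A s i) 2 ν := by
  have := hν.isProbabilityMeasure
  refine MemLp.of_bound (Measurable.aestronglyMeasurable (by unfold State.A; fun_prop))
    (S.Amax i) ?_
  filter_upwards [hν.arrival_mem i] with s hs
  rw [Real.norm_of_nonneg ((S.Amin_nonneg i).trans hs.1)]
  exact hs.2

theorem driftConst_nonneg (ν : Measure (State N)) : 0 ≤ S.driftConst ν :=
  mul_nonneg (by norm_num) (Finset.sum_nonneg fun i _ =>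
    add_nonneg (integral_nonneg fun s => sq_nonneg _) (integral_nonneg fun s => sq_nonneg _))

end Decision

/-! ### Queues of a causal policy -/

section Queue

variable {S : System N} {ν : Measure (State N)} {Ω : Type*} [m : MeasurableSpace Ω]
  {μ : Measure Ω} {𝒢 : Filtration ℕ m} {s : ℕ → Ω → State N} {x : ℕ → Ω → Action N}

theorem IsStateProcess.measurable (hs : IsStateProcess μ ν 𝒢 s) (t : ℕ) : Measurable (s t) :=
  (hs.adapted t).mono (𝒢.le t) le_rfl

theorem IsStateProcess.ae_of_ae (hs : IsStateProcess μ ν 𝒢 s) {p : State N → Prop}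
    (h : ∀ᵐ z ∂ν, p z) (t : ℕ) : ∀ᵐ ω ∂μ, p (s t ω) :=
  ae_of_ae_map (hs.measurable t).aemeasurable (by rwa [hs.law t])

theorem IsStateProcess.integral_comp (hs : IsStateProcess μ ν 𝒢 s) {g : State N → ℝ}
    (hg : Measurable g) (t : ℕ) : ∫ ω, g (s t ω) ∂μ = ∫ z, g z ∂ν := by
  rw [← hs.law t, integral_map (hs.measurable t).aemeasurable hg.aestronglyMeasurable]

theorem IsStateProcess.memLp_comp (hs : IsStateProcess μ ν 𝒢 s) {g : State N → ℝ}
    (hg : MemLp g 2 ν) (t : ℕ) : MemLp (fun ω => g (s t ω)) 2 μ :=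
  MemLp.comp_of_map (by rwa [hs.law t]) (hs.measurable t).aemeasurable

theorem IsPolicy.measurable (hx : S.IsPolicy μ 𝒢 x) (t : ℕ) : Measurable (x t) :=
  (hx.adapted t).mono (𝒢.le t) le_rfl

/-- The queue lengths at the start of slot `t + 1` are determined by the information available in
slot `t`. -/
theorem measurable_queue_succ (hs : IsStateProcess μ ν 𝒢 s) (hx : S.IsPolicy μ 𝒢 x) (t : ℕ)
    (i : Fin N) : Measurable[𝒢 t] fun ω => S.queue s x (t + 1) ω i := by
  have hstep : ∀ t, Measurable[𝒢 t] (fun ω => S.queue s x t ω i) →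
      Measurable[𝒢 t] fun ω => S.queue s x (t + 1) ω i := fun t ht => by
    have hD : Measurable[𝒢 t] fun ω => S.departure (State.h (s t ω)) (x t ω) i :=
      (S.measurable_departure i).comp ((hs.adapted t).prodMk (hx.adapted t))
    have hA : Measurable[𝒢 t] fun ω => State.A (s t ω) i :=
      (measurable_pi_apply i).comp (measurable_fst.comp (hs.adapted t))
    exact ((ht.sub hD).max measurable_const).add hA
  induction t with
  | zero => exact hstep 0 measurable_const
  | succ t ih => exact hstep (t + 1) (ih.mono (𝒢.mono t.le_succ) le_rfl)

theorem measurable_queue (hs : IsStateProcess μ ν 𝒢 s) (hx : S.IsPolicy μ 𝒢 x) (t : ℕ)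
    (i : Fin N) : Measurable fun ω => S.queue s x t ω i := by
  cases t with
  | zero => exact measurable_const
  | succ t => exact (measurable_queue_succ hs hx t i).mono (𝒢.le t) le_rfl

theorem measurable_departure_policy (hs : IsStateProcess μ ν 𝒢 s) (hx : S.IsPolicy μ 𝒢 x) (t : ℕ)
    (i : Fin N) : Measurable fun ω => S.departure (State.h (s t ω)) (x t ω) i :=
  (S.measurable_departure i).comp ((hs.measurable t).prodMk (hx.measurable t))

theorem ae_queue_mem (hν : S.IsStateLaw ν) (hs : IsStateProcess μ ν 𝒢 s)
    (hx : S.IsPolicy μ 𝒢 x) (t : ℕ) (i : Fin N) :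
    ∀ᵐ ω ∂μ, S.queue s x t ω i ∈ Set.Icc 0 (t * S.Amax i) := by
  induction t with
  | zero => exact Eventually.of_forall fun ω => by simp [queue]
  | succ t ih =>
    filter_upwards [ih, hs.ae_of_ae (hν.arrival_mem i) t, hs.ae_of_ae (hν.fading_nonneg i) t,
      hx.mem t] with ω hq hA hh hm
    have hd := S.departure_nonneg hm hh
    have hA0 := (S.Amin_nonneg i).trans hA.1
    refine ⟨add_nonneg (le_max_right _ _) hA0, ?_⟩
    have h1 : max (S.queue s x t ω i - S.departure (State.h (s t ω)) (x t ω) i) 0 ≤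
        t * S.Amax i := max_le (by linarith [hq.2]) (hq.1.trans hq.2)
    have h2 := hA.2
    push_cast
    change max (S.queue s x t ω i - S.departure (State.h (s t ω)) (x t ω) i) 0 +
      State.A (s t ω) i ≤ _
    linarith

theorem memLp_departure_policy (hν : S.IsStateLaw ν) (hs : IsStateProcess μ ν 𝒢 s)
    (hx : S.IsPolicy μ 𝒢 x) (t : ℕ) (i : Fin N) :
    MemLp (fun ω => S.departure (State.h (s t ω)) (x t ω) i) 2 μ := by
  refine (hs.memLp_comp (S.memLp_maxDeparture hν i) t).of_le
    (measurable_departure_policy hs hx t i).aestronglyMeasurable ?_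
  filter_upwards [hs.ae_of_ae (hν.fading_nonneg i) t, hx.mem t] with ω hh hm
  rw [Real.norm_of_nonneg (S.departure_nonneg hm hh),
    Real.norm_of_nonneg (S.maxDeparture_nonneg hh i)]
  exact S.departure_le_maxDeparture hm hh

theorem integral_power_policy_nonneg (hx : S.IsPolicy μ 𝒢 x) (t : ℕ) :
    0 ≤ ∫ ω, S.power (x t ω) ∂μ :=
  integral_nonneg_of_ae ((hx.mem t).mono fun _ h => S.power_nonneg h)

theorem integral_queue_nonneg (hν : S.IsStateLaw ν) (hs : IsStateProcess μ ν 𝒢 s)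
    (hx : S.IsPolicy μ 𝒢 x) (t : ℕ) (i : Fin N) : 0 ≤ ∫ ω, S.queue s x t ω i ∂μ :=
  integral_nonneg_of_ae ((ae_queue_mem hν hs hx t i).mono fun _ h => h.1)

theorem integral_abs_queue (hν : S.IsStateLaw ν) (hs : IsStateProcess μ ν 𝒢 s)
    (hx : S.IsPolicy μ 𝒢 x) (t : ℕ) (i : Fin N) :
    ∫ ω, |S.queue s x t ω i| ∂μ = ∫ ω, S.queue s x t ω i ∂μ :=
  integral_congr_ae ((ae_queue_mem hν hs hx t i).mono fun _ h => abs_of_nonneg h.1)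

theorem half_sum_integral_sq_nonneg (T : ℕ) :
    0 ≤ (1 / 2) * ∑ i, ∫ ω, S.queue s x T ω i ^ 2 ∂μ :=
  mul_nonneg (by norm_num)
    (Finset.sum_nonneg fun i _ => integral_nonneg fun ω => sq_nonneg _)

variable [IsProbabilityMeasure μ]

theorem indepFun_queue_state (hs : IsStateProcess μ ν 𝒢 s) (hx : S.IsPolicy μ 𝒢 x) (t : ℕ)
    (i : Fin N) : IndepFun (fun ω => S.queue s x t ω i) (s t) μ := by
  cases t with
  | zero => exact indepFun_const_left (0 : ℝ) _
  | succ t =>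
    rw [IndepFun_iff_Indep]
    exact indep_of_indep_of_le_left (hs.indep t).symm (measurable_queue_succ hs hx t i).comap_le

theorem memLp_queue (hν : S.IsStateLaw ν) (hs : IsStateProcess μ ν 𝒢 s)
    (hx : S.IsPolicy μ 𝒢 x) (t : ℕ) (i : Fin N) :
    MemLp (fun ω => S.queue s x t ω i) 2 μ := by
  refine MemLp.of_bound (measurable_queue hs hx t i).aestronglyMeasurable (t * S.Amax i) ?_
  filter_upwards [ae_queue_mem hν hs hx t i] with ω hω
  rw [Real.norm_of_nonneg hω.1]
  exact hω.2

theorem integrable_power_policy (hx : S.IsPolicy μ 𝒢 x) (t : ℕ) :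
    Integrable (fun ω => S.power (x t ω)) μ := by
  refine Integrable.of_bound
    (S.continuous_power.measurable.comp (hx.measurable t)).aestronglyMeasurable
    (∑ i, (S.pmax i + S.κ * S.fmax i ^ 3)) ?_
  filter_upwards [hx.mem t] with ω hm
  rw [Real.norm_of_nonneg (S.power_nonneg hm)]
  exact S.power_le hm

theorem integral_power_policy_le (hx : S.IsPolicy μ 𝒢 x) (t : ℕ) :
    ∫ ω, S.power (x t ω) ∂μ ≤ ∑ i, (S.pmax i + S.κ * S.fmax i ^ 3) := by
  refine (integral_mono_ae (integrable_power_policy hx t) (integrable_const _)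
    ((hx.mem t).mono fun _ h => S.power_le h)).trans (le_of_eq ?_)
  simp

/-- The current queue lengths are independent of the current state. -/
theorem integral_queue_mul (hs : IsStateProcess μ ν 𝒢 s) (hx : S.IsPolicy μ 𝒢 x) (t : ℕ)
    (i : Fin N) {g : State N → ℝ} (hg : Measurable g) :
    ∫ ω, S.queue s x t ω i * g (s t ω) ∂μ = (∫ ω, S.queue s x t ω i ∂μ) * ∫ z, g z ∂ν := by
  rw [← hs.integral_comp hg t]
  exact ((indepFun_queue_state hs hx t i).comp measurable_id hg).integral_fun_mul_eq_mul_integral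
    (measurable_queue hs hx t i).aestronglyMeasurable
    (hg.comp (hs.measurable t)).aestronglyMeasurable

/-- One step of the queue recursion, for the quadratic Lyapunov function. -/
theorem sq_queue_step_le {q d a : ℝ} (hq : 0 ≤ q) (hd : 0 ≤ d) (ha : 0 ≤ a) :
    (max (q - d) 0 + a) ^ 2 ≤ q ^ 2 + (a ^ 2 + d ^ 2) + (2 * (q * a) - 2 * (q * d)) := by
  rcases le_total 0 (q - d) with h | h
  · rw [max_eq_left h]
    nlinarith [mul_nonneg hd ha]
  · rw [max_eq_right h]
    nlinarith [mul_nonneg hq ha, sq_nonneg (q - d)]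

/-- The drift bound in expectation: the second moment of a queue grows by at most a constant plus
twice the correlation of the queue length with the excess of arrivals over departures. -/
theorem integral_sq_queue_succ_le (hν : S.IsStateLaw ν) (hs : IsStateProcess μ ν 𝒢 s)
    (hx : S.IsPolicy μ 𝒢 x) (t : ℕ) (i : Fin N) :
    ∫ ω, S.queue s x (t + 1) ω i ^ 2 ∂μ ≤ ∫ ω, S.queue s x t ω i ^ 2 ∂μ +
      ((∫ z, State.A z i ^ 2 ∂ν) + ∫ z, S.maxDeparture (State.h z i) i ^ 2 ∂ν) +
      (2 * ((∫ ω, S.queue s x t ω i ∂μ) * ∫ z, State.A z i ∂ν) -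
        2 * ∫ ω, S.queue s x t ω i * S.departure (State.h (s t ω)) (x t ω) i ∂μ) := by
  have hA : Measurable fun z : State N => State.A z i := by unfold State.A; fun_prop
  have hM := S.measurable_maxDeparture i
  have hQ := memLp_queue hν hs hx t i
  have i1 := hQ.integrable_sq
  have i2 := (hs.memLp_comp (S.memLp_arrival hν i) t).integrable_sq
  have i3 := (hs.memLp_comp (S.memLp_maxDeparture hν i) t).integrable_sq
  have i4 : Integrable (fun ω => S.queue s x t ω i * State.A (s t ω) i) μ :=
    hQ.integrable_mul (hs.memLp_comp (S.memLp_arrival hν i) t)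
  have i5 : Integrable
      (fun ω => S.queue s x t ω i * S.departure (State.h (s t ω)) (x t ω) i) μ :=
    hQ.integrable_mul (memLp_departure_policy hν hs hx t i)
  have i23 : Integrable
      (fun ω => State.A (s t ω) i ^ 2 + S.maxDeparture (State.h (s t ω) i) i ^ 2) μ := i2.add i3
  have i123 : Integrable (fun ω => S.queue s x t ω i ^ 2 +
      (State.A (s t ω) i ^ 2 + S.maxDeparture (State.h (s t ω) i) i ^ 2)) μ := i1.add i23
  have i45 : Integrable (fun ω => 2 * (S.queue s x t ω i * State.A (s t ω) i) -
      2 * (S.queue s x t ω i * S.departure (State.h (s t ω)) (x t ω) i)) μ :=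
    (i4.const_mul 2).sub (i5.const_mul 2)
  rw [← hs.integral_comp (hA.pow_const 2) t, ← hs.integral_comp (hM.pow_const 2) t,
    ← integral_queue_mul hs hx t i hA, ← integral_const_mul, ← integral_const_mul,
    ← integral_add i2 i3, ← integral_sub (i4.const_mul 2) (i5.const_mul 2),
    ← integral_add i1 i23, ← integral_add i123 i45]
  refine integral_mono_ae (memLp_queue hν hs hx (t + 1) i).integrable_sq (i123.add i45) ?_
  filter_upwards [ae_queue_mem hν hs hx t i, hs.ae_of_ae (hν.arrival_mem i) t,
    hs.ae_of_ae (hν.fading_nonneg i) t, hx.mem t] with ω hq hA hh hm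
  have hd := S.departure_nonneg hm hh
  refine (sq_queue_step_le hq.1 hd ((S.Amin_nonneg i).trans hA.1)).trans ?_
  have := pow_le_pow_left₀ hd (S.departure_le_maxDeparture hm hh) 2
  gcongr

/-- A queue is at least the excess of all arrivals over all departures. -/
theorem sum_arrival_sub_departure_le (hν : S.IsStateLaw ν) (hs : IsStateProcess μ ν 𝒢 s)
    (hx : S.IsPolicy μ 𝒢 x) (T : ℕ) (i : Fin N) :
    T * (∫ z, State.A z i ∂ν) -
      ∑ t ∈ Finset.range T, ∫ ω, S.departure (State.h (s t ω)) (x t ω) i ∂μ ≤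
      ∫ ω, S.queue s x T ω i ∂μ := by
  induction T with
  | zero => simp [queue]
  | succ t ih =>
    have hA : Measurable fun z : State N => State.A z i := by unfold State.A; fun_prop
    have i1 := (memLp_queue hν hs hx t i).integrable one_le_two
    have i2 := (memLp_departure_policy hν hs hx t i).integrable one_le_two
    have i3 := (hs.memLp_comp (S.memLp_arrival hν i) t).integrable one_le_two
    have i12 : Integrable (fun ω =>
        S.queue s x t ω i - S.departure (State.h (s t ω)) (x t ω) i) μ := i1.sub i2
    have h : (∫ ω, S.queue s x t ω i ∂μ) -
        (∫ ω, S.departure (State.h (s t ω)) (x t ω) i ∂μ) + ∫ z, State.A z i ∂ν ≤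
        ∫ ω, S.queue s x (t + 1) ω i ∂μ := by
      rw [← hs.integral_comp hA t, ← integral_sub i1 i2, ← integral_add i12 i3]
      refine integral_mono (i12.add i3)
        ((memLp_queue hν hs hx (t + 1) i).integrable one_le_two) fun ω => ?_
      exact add_le_add_left (le_max_left _ _) _
    rw [Finset.sum_range_succ]
    push_cast
    linarith

/-- Linear growth of the second moment gives mean rate stability, since
`2 √t q ≤ q² + t`. -/
theorem meanRateStable_of_integral_sq_le (hν : S.IsStateLaw ν) (hs : IsStateProcess μ ν 𝒢 s)
    (hx : S.IsPolicy μ 𝒢 x) (i : Fin N) {c : ℝ}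
    (h : ∀ t : ℕ, ∫ ω, S.queue s x t ω i ^ 2 ∂μ ≤ c * t) : S.MeanRateStable μ s x i := by
  have hlim : Tendsto (fun t : ℕ => (c + 1) / 2 / √(t : ℝ)) atTop (𝓝 0) :=
    tendsto_const_nhds.div_atTop (Real.tendsto_sqrt_atTop.comp tendsto_natCast_atTop_atTop)
  refine tendsto_of_tendsto_of_tendsto_of_le_of_le' tendsto_const_nhds hlim
    (Eventually.of_forall fun t => by positivity) ?_
  filter_upwards [eventually_gt_atTop 0] with t ht
  have ht' : (0 : ℝ) < t := Nat.cast_pos.2 ht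
  have hs0 : 0 < √(t : ℝ) := Real.sqrt_pos.2 ht'
  have hss : √(t : ℝ) * √(t : ℝ) = t := Real.mul_self_sqrt ht'.le
  rw [integral_abs_queue hν hs hx]
  have hQ := memLp_queue hν hs hx t i
  have h1 : 2 * √(t : ℝ) * ∫ ω, S.queue s x t ω i ∂μ ≤ c * t + t := by
    have : ∫ ω, 2 * √(t : ℝ) * S.queue s x t ω i ∂μ ≤ ∫ ω, (S.queue s x t ω i ^ 2 + t) ∂μ := by
      refine integral_mono ((hQ.integrable one_le_two).const_mul _)
        (hQ.integrable_sq.add (integrable_const _)) fun ω => ?_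
      change 2 * √(t : ℝ) * S.queue s x t ω i ≤ S.queue s x t ω i ^ 2 + t
      nlinarith [sq_nonneg (S.queue s x t ω i - √(t : ℝ))]
    rw [integral_const_mul, integral_add hQ.integrable_sq (integrable_const _)] at this
    simp only [integral_const, probReal_univ, one_smul] at this
    linarith [h t]
  rw [div_div, div_le_div_iff₀ ht' (by positivity)]
  linarith

end Queue

/-! ### Attainable mean departures and mean power -/

section Attainable

variable (S : System N) (ν : Measure (State N))

/-- The pairs `(d, p)` for which some stationary deterministic policy, that is, a measurable map
from the state of a slot to an allowed decision, has mean departures at least `d` and mean power at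
most `p`. Randomization is not needed in the definition, because departures are concave and power is
convex in the decision. -/
def attainable : Set ((Fin N → ℝ) × ℝ) :=
  {r | ∃ F : State N → Action N, Measurable F ∧ (∀ᵐ z ∂ν, F z ∈ S.feasible) ∧
    (∀ i, r.1 i ≤ ∫ z, S.departure (State.h z) (F z) i ∂ν) ∧ ∫ z, S.power (F z) ∂ν ≤ r.2}

variable {S ν}

theorem integrable_departure_comp (hν : S.IsStateLaw ν) {F : State N → Action N}
    (hF : Measurable F) (hm : ∀ᵐ z ∂ν, F z ∈ S.feasible) (i : Fin N) :
    Integrable (fun z => S.departure (State.h z) (F z) i) ν := by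
  have := hν.isProbabilityMeasure
  refine ((S.memLp_maxDeparture hν i).integrable one_le_two).mono'
    ((S.measurable_departure i).comp (measurable_id.prodMk hF)).aestronglyMeasurable ?_
  filter_upwards [hm, hν.fading_nonneg i] with z hz hh
  rw [Real.norm_of_nonneg (S.departure_nonneg hz hh)]
  exact S.departure_le_maxDeparture hz hh

theorem integrable_power_comp [IsFiniteMeasure ν] {F : State N → Action N}
    (hF : Measurable F) (hm : ∀ᵐ z ∂ν, F z ∈ S.feasible) :
    Integrable (fun z => S.power (F z)) ν := by
  refine Integrable.of_bound (S.continuous_power.measurable.comp hF).aestronglyMeasurable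
    (∑ i, (S.pmax i + S.κ * S.fmax i ^ 3)) ?_
  filter_upwards [hm] with z hz
  rw [Real.norm_of_nonneg (S.power_nonneg hz)]
  exact S.power_le hz

theorem convex_attainable (hν : S.IsStateLaw ν) : Convex ℝ (S.attainable ν) := by
  have := hν.isProbabilityMeasure
  rintro r ⟨F, hF, hFm, hFd, hFp⟩ r' ⟨G, hG, hGm, hGd, hGp⟩ a b ha hb hab
  have hH : Measurable fun z => a • F z + b • G z := (hF.const_smul a).add (hG.const_smul b)
  have hHm : ∀ᵐ z ∂ν, a • F z + b • G z ∈ S.feasible := by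
    filter_upwards [hFm, hGm] with z h1 h2 using S.convex_feasible h1 h2 ha hb hab
  refine ⟨fun z => a • F z + b • G z, hH, hHm, fun i => ?_, ?_⟩
  · have i1 := integrable_departure_comp hν hF hFm i
    have i2 := integrable_departure_comp hν hG hGm i
    calc a * r.1 i + b * r'.1 i
        ≤ a * ∫ z, S.departure (State.h z) (F z) i ∂ν +
          b * ∫ z, S.departure (State.h z) (G z) i ∂ν :=
          add_le_add (mul_le_mul_of_nonneg_left (hFd i) ha)
            (mul_le_mul_of_nonneg_left (hGd i) hb)
      _ = ∫ z, (a * S.departure (State.h z) (F z) i + b * S.departure (State.h z) (G z) i) ∂ν := by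
          rw [integral_add (i1.const_mul a) (i2.const_mul b), integral_const_mul,
            integral_const_mul]
      _ ≤ _ := by
          refine integral_mono_ae ((i1.const_mul a).add (i2.const_mul b))
            (integrable_departure_comp hν hH hHm i) ?_
          filter_upwards [hFm, hGm, hν.fading_nonneg i] with z h1 h2 hh
          exact (S.concaveOn_departure hh).2 h1 h2 ha hb hab
  · have i1 := integrable_power_comp hF hFm
    have i2 := integrable_power_comp hG hGm
    calc ∫ z, S.power (a • F z + b • G z) ∂ν
        ≤ ∫ z, (a * S.power (F z) + b * S.power (G z)) ∂ν := by
          refine integral_mono_ae (integrable_power_comp hH hHm)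
            ((i1.const_mul a).add (i2.const_mul b)) ?_
          filter_upwards [hFm, hGm] with z h1 h2
          exact S.convexOn_power.2 h1 h2 ha hb hab
      _ = a * ∫ z, S.power (F z) ∂ν + b * ∫ z, S.power (G z) ∂ν := by
          rw [integral_add (i1.const_mul a) (i2.const_mul b), integral_const_mul,
            integral_const_mul]
      _ ≤ a * r.2 + b * r'.2 :=
          add_le_add (mul_le_mul_of_nonneg_left hFp ha) (mul_le_mul_of_nonneg_left hGp hb)

/-- Derandomization: by Jensen's inequality, replacing the random decision in each state by its
mean loses neither departures nor power. -/
theorem mem_attainable_of_kernel (hν : S.IsStateLaw ν) (K : Kernel (State N) (Action N))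
    [IsMarkovKernel K] (hK : ∀ᵐ z ∂ν, ∀ᵐ a ∂(K z), a ∈ S.feasible) :
    ((fun i => ∫ z, ∫ a, S.departure (State.h z) a i ∂(K z) ∂ν,
      ∫ z, ∫ a, S.power a ∂(K z) ∂ν) : (Fin N → ℝ) × ℝ) ∈ S.attainable ν := by
  have := hν.isProbabilityMeasure
  obtain ⟨B, hB⟩ := S.exists_norm_le_of_mem_feasible
  have hid : ∀ {z}, (∀ᵐ a ∂(K z), a ∈ S.feasible) → Integrable (fun a : Action N => a) (K z) :=
    fun h => Integrable.of_bound measurable_id.aestronglyMeasurable B (h.mono hB)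
  have hpow : ∀ {z}, (∀ᵐ a ∂(K z), a ∈ S.feasible) → Integrable S.power (K z) := fun h => by
    refine Integrable.of_bound S.continuous_power.measurable.aestronglyMeasurable
      (∑ i, (S.pmax i + S.κ * S.fmax i ^ 3)) (h.mono fun a ha => ?_)
    rw [Real.norm_of_nonneg (S.power_nonneg ha)]
    exact S.power_le ha
  have hdep : ∀ {z i}, 0 ≤ State.h z i → (∀ᵐ a ∂(K z), a ∈ S.feasible) →
      Integrable (fun a => S.departure (State.h z) a i) (K z) := fun {z i} hh h => by
    refine Integrable.of_bound
      ((S.measurable_departure i).comp measurable_prodMk_left).aestronglyMeasurable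
      (S.maxDeparture (State.h z i) i) (h.mono fun a ha => ?_)
    rw [Real.norm_of_nonneg (S.departure_nonneg ha hh)]
    exact S.departure_le_maxDeparture ha hh
  have hF : Measurable fun z => ∫ a, a ∂(K z) :=
    (StronglyMeasurable.integral_kernel_prod_right' (κ := K)
      (f := fun q : State N × Action N => q.2) measurable_snd.stronglyMeasurable).measurable
  have hFm : ∀ᵐ z ∂ν, ∫ a, a ∂(K z) ∈ S.feasible := by
    filter_upwards [hK] with z hz
    exact S.convex_feasible.integral_mem S.isClosed_feasible hz (hid hz)
  refine ⟨fun z => ∫ a, a ∂(K z), hF, hFm, fun i => ?_, ?_⟩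
  · refine integral_mono_ae ?_ (integrable_departure_comp hν hF hFm i) ?_
    · refine ((S.memLp_maxDeparture hν i).integrable one_le_two).mono'
        (StronglyMeasurable.integral_kernel_prod_right' (κ := K)
          (S.measurable_departure i).stronglyMeasurable).aestronglyMeasurable ?_
      filter_upwards [hK, hν.fading_nonneg i] with z hz hh
      rw [Real.norm_of_nonneg
        (integral_nonneg_of_ae (hz.mono fun a ha => S.departure_nonneg ha hh))]
      refine (integral_mono_ae (hdep hh hz) (integrable_const _)
        (hz.mono fun a ha => S.departure_le_maxDeparture ha hh)).trans (le_of_eq ?_)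
      simp
    · filter_upwards [hK, hν.fading_nonneg i] with z hz hh
      exact (S.concaveOn_departure hh).le_map_integral (S.continuousOn_departure hh)
        S.isClosed_feasible hz (hid hz) (hdep hh hz)
  · refine integral_mono_ae (integrable_power_comp hF hFm) ?_ ?_
    · refine Integrable.of_bound (StronglyMeasurable.integral_kernel_prod_right' (κ := K)
        (f := fun q : State N × Action N => S.power q.2)
        (S.continuous_power.measurable.comp
          measurable_snd).stronglyMeasurable).aestronglyMeasurable
        (∑ i, (S.pmax i + S.κ * S.fmax i ^ 3)) ?_
      filter_upwards [hK] with z hz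
      rw [Real.norm_of_nonneg (integral_nonneg_of_ae (hz.mono fun a ha => S.power_nonneg ha))]
      refine (integral_mono_ae (hpow hz) (integrable_const _)
        (hz.mono fun a ha => S.power_le ha)).trans (le_of_eq ?_)
      simp
    · filter_upwards [hK] with z hz
      exact S.convexOn_power.map_integral_le S.continuous_power.continuousOn
        S.isClosed_feasible hz (hid hz) (hpow hz)

theorem mem_attainable_of_slater (hν : S.IsStateLaw ν) {ε Ψ : ℝ} (h : S.Slater ν ε Ψ) :
    ((fun i => (∫ z, State.A z i ∂ν) + ε, Ψ) : (Fin N → ℝ) × ℝ) ∈ S.attainable ν := by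
  obtain ⟨K, hK, hm, hp, hd⟩ := h
  obtain ⟨F, hF, hFm, hFd, hFp⟩ := mem_attainable_of_kernel hν K hm
  exact ⟨F, hF, hFm, fun i => (hd i).trans (hFd i), hFp.trans hp.le⟩

variable {Ω : Type*} [m : MeasurableSpace Ω] {μ : Measure Ω} [IsProbabilityMeasure μ]
  {𝒢 : Filtration ℕ m} {s : ℕ → Ω → State N} {x : ℕ → Ω → Action N}

/-- The mean departures and the mean power of any causal policy in one slot are attainable: the
conditional distribution of its decision given the state is a stationary randomized policy. -/
theorem mem_attainable_of_policy (hν : S.IsStateLaw ν) (hs : IsStateProcess μ ν 𝒢 s)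
    (hx : S.IsPolicy μ 𝒢 x) (t : ℕ) :
    ((fun i => ∫ ω, S.departure (State.h (s t ω)) (x t ω) i ∂μ,
      ∫ ω, S.power (x t ω) ∂μ) : (Fin N → ℝ) × ℝ) ∈ S.attainable ν := by
  have := hν.isProbabilityMeasure
  have hsx : Measurable fun ω => (s t ω, x t ω) := (hs.measurable t).prodMk (hx.measurable t)
  have hcomp : ν ⊗ₘ condDistrib (x t) (s t) μ = μ.map fun ω => (s t ω, x t ω) := by
    rw [← compProd_map_condDistrib (hx.measurable t).aemeasurable, hs.law t]
  have hK : ∀ᵐ z ∂ν, ∀ᵐ a ∂(condDistrib (x t) (s t) μ z), a ∈ S.feasible := by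
    refine Measure.ae_ae_of_ae_compProd (p := fun q => q.2 ∈ S.feasible) ?_
    rw [hcomp, ae_map_iff hsx.aemeasurable (measurable_snd S.isClosed_feasible.measurableSet)]
    exact hx.mem t
  have hint : ∀ {g : State N × Action N → ℝ}, Measurable g →
      Integrable (fun ω => g (s t ω, x t ω)) μ →
      ∫ z, ∫ a, g (z, a) ∂(condDistrib (x t) (s t) μ z) ∂ν = ∫ ω, g (s t ω, x t ω) ∂μ :=
    fun {g} hg hi => by
      rw [← integral_map hsx.aemeasurable hg.aestronglyMeasurable, ← hcomp,
        Measure.integral_compProd]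
      rw [hcomp]
      exact (integrable_map_measure hg.aestronglyMeasurable hsx.aemeasurable).2 hi
  have h := mem_attainable_of_kernel hν (condDistrib (x t) (s t) μ) hK
  have hd : ∀ i, ∫ z, ∫ a, S.departure (State.h z) a i ∂(condDistrib (x t) (s t) μ z) ∂ν =
      ∫ ω, S.departure (State.h (s t ω)) (x t ω) i ∂μ := fun i =>
    hint (S.measurable_departure i) ((memLp_departure_policy hν hs hx t i).integrable one_le_two)
  have hp : ∫ z, ∫ a, S.power a ∂(condDistrib (x t) (s t) μ z) ∂ν =
      ∫ ω, S.power (x t ω) ∂μ :=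
    hint (g := fun q => S.power q.2) (S.continuous_power.measurable.comp measurable_snd)
      (integrable_power_policy hx t)
  simpa only [hd, hp] using h

/-- Time averages of a causal policy are attainable. The departures are at least the arrivals up
to the mean rate at which the backlog has grown. -/
theorem average_mem_attainable (hν : S.IsStateLaw ν) (hs : IsStateProcess μ ν 𝒢 s)
    (hx : S.IsPolicy μ 𝒢 x) {T : ℕ} (hT : 0 < T) :
    ((fun i => (∫ z, State.A z i ∂ν) - (∫ ω, |S.queue s x T ω i| ∂μ) / T,
      1 / (T : ℝ) * ∫ ω, ∑ t ∈ Finset.range T, S.power (x t ω) ∂μ) : (Fin N → ℝ) × ℝ) ∈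
      S.attainable ν := by
  have hT' : (0 : ℝ) < T := Nat.cast_pos.2 hT
  have h := (convex_attainable hν).sum_mem (t := Finset.range T) (w := fun _ => 1 / (T : ℝ))
    (z := fun t => ((fun i => ∫ ω, S.departure (State.h (s t ω)) (x t ω) i ∂μ,
      ∫ ω, S.power (x t ω) ∂μ) : (Fin N → ℝ) × ℝ))
    (fun _ _ => by positivity)
    (by rw [Finset.sum_const, Finset.card_range, nsmul_eq_mul]; field_simp)
    fun t _ => mem_attainable_of_policy hν hs hx t
  obtain ⟨F, hF, hFm, hFd, hFp⟩ := h
  refine ⟨F, hF, hFm, fun i => le_trans ?_ (hFd i), hFp.trans (le_of_eq ?_)⟩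
  · have hq := sum_arrival_sub_departure_le hν hs hx T i
    simp only [Prod.fst_sum, Finset.sum_apply, Prod.smul_fst, Pi.smul_apply, smul_eq_mul,
      ← Finset.mul_sum]
    rw [integral_abs_queue hν hs hx, sub_le_iff_le_add, one_div, inv_mul_eq_div, ← add_div,
      le_div_iff₀ hT']
    linarith
  · simp only [Prod.snd_sum, Prod.smul_snd, smul_eq_mul, ← Finset.mul_sum]
    rw [integral_finsetSum _ fun t _ => integrable_power_policy hx t]

end Attainable

section Optimum

variable {S : System N} {ν : Measure (State N)} {Ω : Type*} [m : MeasurableSpace Ω]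
  {μ : Measure Ω} [IsProbabilityMeasure μ] {𝒢 : Filtration ℕ m} {s : ℕ → Ω → State N}
  {x y : ℕ → Ω → Action N}

/-! ### Average power and the optimal value -/

theorem integral_sum_power (hx : S.IsPolicy μ 𝒢 x) (T : ℕ) :
    ∫ ω, ∑ t ∈ Finset.range T, S.power (x t ω) ∂μ =
      ∑ t ∈ Finset.range T, ∫ ω, S.power (x t ω) ∂μ :=
  integral_finsetSum _ fun t _ => integrable_power_policy hx t

theorem average_power_nonneg (hx : S.IsPolicy μ 𝒢 x) (T : ℕ) :
    0 ≤ 1 / (T : ℝ) * ∫ ω, ∑ t ∈ Finset.range T, S.power (x t ω) ∂μ := by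
  rw [integral_sum_power hx]
  exact mul_nonneg (by positivity)
    (Finset.sum_nonneg fun t _ => integral_power_policy_nonneg hx t)

theorem isBoundedUnder_average_power (hx : S.IsPolicy μ 𝒢 x) :
    IsBoundedUnder (· ≤ ·) atTop fun T : ℕ =>
      1 / (T : ℝ) * ∫ ω, ∑ t ∈ Finset.range T, S.power (x t ω) ∂μ := by
  refine isBoundedUnder_of_eventually_le (a := ∑ i, (S.pmax i + S.κ * S.fmax i ^ 3)) ?_
  filter_upwards [eventually_gt_atTop 0] with T hT
  have hT' : (0 : ℝ) < T := Nat.cast_pos.2 hT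
  rw [integral_sum_power hx, one_div, inv_mul_le_iff₀ hT']
  refine (Finset.sum_le_sum fun t _ => integral_power_policy_le hx t).trans (le_of_eq ?_)
  rw [Finset.sum_const, Finset.card_range, nsmul_eq_mul]

theorem isCoboundedUnder_average_power (hx : S.IsPolicy μ 𝒢 x) :
    IsCoboundedUnder (· ≤ ·) atTop fun T : ℕ =>
      1 / (T : ℝ) * ∫ ω, ∑ t ∈ Finset.range T, S.power (x t ω) ∂μ :=
  (isBoundedUnder_of ⟨0, average_power_nonneg hx⟩ :
    IsBoundedUnder (· ≥ ·) atTop _).isCoboundedUnder_le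

theorem avgPower_nonneg (hx : S.IsPolicy μ 𝒢 x) : 0 ≤ S.avgPower μ x :=
  le_limsup_of_frequently_le (Frequently.of_forall (average_power_nonneg hx))
    (isBoundedUnder_average_power hx)

theorem optPower_le_avgPower (hx : S.IsFeasiblePolicy μ 𝒢 s x) :
    S.optPower μ 𝒢 s ≤ S.avgPower μ x := by
  refine csInf_le ⟨0, ?_⟩ ⟨x, hx, rfl⟩
  rintro _ ⟨y, hy, rfl⟩
  exact avgPower_nonneg hy.toIsPolicy

/-- A stationary policy whose mean departures are at least the mean arrivals keeps the queues mean
rate stable, so its power bounds the optimal value. No slack is needed: the second moments of the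
queues still grow at most linearly. -/
theorem optPower_le_of_mem_attainable (hν : S.IsStateLaw ν) (hs : IsStateProcess μ ν 𝒢 s)
    {r : (Fin N → ℝ) × ℝ} (hr : r ∈ S.attainable ν) (hA : ∀ i, ∫ z, State.A z i ∂ν ≤ r.1 i) :
    S.optPower μ 𝒢 s ≤ r.2 := by
  obtain ⟨F, hF, hFm, hFd, hFp⟩ := hr
  have hpol : S.IsPolicy μ 𝒢 fun t ω => F (s t ω) :=
    ⟨fun t => hF.comp (hs.adapted t), fun t => hs.ae_of_ae hFm t⟩
  have hstable : ∀ i, S.MeanRateStable μ s (fun t ω => F (s t ω)) i := fun i => by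
    refine meanRateStable_of_integral_sq_le hν hs hpol i (c := (∫ z, State.A z i ^ 2 ∂ν) +
      ∫ z, S.maxDeparture (State.h z i) i ^ 2 ∂ν) fun t => ?_
    induction t with
    | zero => simp [queue]
    | succ t ih =>
      have h := integral_sq_queue_succ_le hν hs hpol t i
      rw [integral_queue_mul hs hpol t i
        (g := fun z => S.departure (State.h z) (F z) i)
        ((S.measurable_departure i).comp (measurable_id.prodMk hF))] at h
      have h' := mul_le_mul_of_nonneg_left ((hA i).trans (hFd i))
        (integral_queue_nonneg hν hs hpol t i)
      push_cast
      linarith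
  have hlim : Tendsto (fun T : ℕ =>
      1 / (T : ℝ) * ∫ ω, ∑ t ∈ Finset.range T, S.power (F (s t ω)) ∂μ) atTop
      (𝓝 (∫ z, S.power (F z) ∂ν)) := by
    refine tendsto_const_nhds.congr' ?_
    filter_upwards [eventually_gt_atTop 0] with T hT
    have hT' : (0 : ℝ) < T := Nat.cast_pos.2 hT
    rw [integral_sum_power hpol]
    simp_rw [hs.integral_comp (g := fun z => S.power (F z))
      (S.continuous_power.measurable.comp hF)]
    rw [Finset.sum_const, Finset.card_range, nsmul_eq_mul]
    field_simp
  exact (optPower_le_avgPower ⟨hpol, hstable⟩).trans (hlim.limsup_eq.le.trans hFp)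

/-- Under the Slater conditions the optimal value bounds even the lower limit of the average power
of a feasible policy. The averages up to a late slot `T` fall short of the arrivals only slightly,
and mixing in the Slater policy with a small weight makes up for it. -/
theorem eventually_optPower_sub_le (hν : S.IsStateLaw ν) (hs : IsStateProcess μ ν 𝒢 s)
    (hx : S.IsFeasiblePolicy μ 𝒢 s x) {ε Ψ : ℝ} (hε : 0 < ε) (hΨ : S.Slater ν ε Ψ) {δ : ℝ}
    (hδ : 0 < δ) : ∀ᶠ T : ℕ in atTop, S.optPower μ 𝒢 s - δ ≤
      1 / (T : ℝ) * ∫ ω, ∑ t ∈ Finset.range T, S.power (x t ω) ∂μ := by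
  set η : ℝ := min 1 (δ / (|Ψ| + 1)) with hη
  have hη0 : 0 < η := lt_min one_pos (by positivity)
  have hη1 : η ≤ 1 := min_le_left _ _
  have hηδ : η * Ψ ≤ δ := by
    have h1 : η * (|Ψ| + 1) ≤ δ := (le_div_iff₀ (by positivity)).1 (min_le_right _ _)
    have h2 := mul_le_mul_of_nonneg_left (le_abs_self Ψ) hη0.le
    linarith
  have hq : ∀ᶠ T : ℕ in atTop, ∀ i, (∫ ω, |S.queue s x T ω i| ∂μ) / T ≤ η * ε :=
    eventually_all.2 fun i => (hx.stable i).eventually_le_const (mul_pos hη0 hε)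
  filter_upwards [hq, eventually_gt_atTop 0] with T hqT hT
  have hmix := convex_attainable hν (average_mem_attainable hν hs hx.toIsPolicy hT)
    (mem_attainable_of_slater hν hΨ) (sub_nonneg.2 hη1) hη0.le (by ring)
  have h := optPower_le_of_mem_attainable hν hs hmix fun i => by
    simp only [Prod.fst_add, Prod.smul_fst, Pi.add_apply, Pi.smul_apply, smul_eq_mul]
    have h0 : 0 ≤ (∫ ω, |S.queue s x T ω i| ∂μ) / T :=
      div_nonneg (integral_nonneg fun _ => abs_nonneg _) (Nat.cast_nonneg T)
    nlinarith [hqT i, mul_nonneg hη0.le h0]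
  simp only [Prod.snd_add, Prod.smul_snd, smul_eq_mul] at h
  nlinarith [mul_nonneg hη0.le (average_power_nonneg hx.toIsPolicy T)]

/-! ### The drift-plus-penalty bound -/

/-- The one-slot bound. The decision of the online algorithm is at least as good as that of any
stationary policy, whose departures are independent of the current queue lengths. -/
theorem IsOnlineRun.drift_le {V : ℝ} (hV : 0 ≤ V) (hν : S.IsStateLaw ν)
    (hs : IsStateProcess μ ν 𝒢 s) (hx : S.IsOnlineRun V μ 𝒢 s x) {r : (Fin N → ℝ) × ℝ}
    (hr : r ∈ S.attainable ν) (t : ℕ) :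
    (1 / 2) * (∑ i, ∫ ω, S.queue s x (t + 1) ω i ^ 2 ∂μ) + V * ∫ ω, S.power (x t ω) ∂μ ≤
      (1 / 2) * (∑ i, ∫ ω, S.queue s x t ω i ^ 2 ∂μ) + S.driftConst ν +
        (∑ i, (∫ ω, S.queue s x t ω i ∂μ) * ((∫ z, State.A z i ∂ν) - r.1 i)) + V * r.2 := by
  obtain ⟨F, hF, hFm, hFd, hFp⟩ := hr
  have hpol := hx.toIsPolicy
  have hFpol : S.IsPolicy μ 𝒢 fun t ω => F (s t ω) :=
    ⟨fun t => hF.comp (hs.adapted t), fun t => hs.ae_of_ae hFm t⟩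
  have hobj : ∀ {y : ℕ → Ω → Action N}, S.IsPolicy μ 𝒢 y →
      Integrable (fun ω => S.perSlotObjective V (S.queue s x t ω) (State.h (s t ω)) (y t ω)) μ ∧
      ∫ ω, S.perSlotObjective V (S.queue s x t ω) (State.h (s t ω)) (y t ω) ∂μ =
        -(∑ i, ∫ ω, S.queue s x t ω i * S.departure (State.h (s t ω)) (y t ω) i ∂μ) +
          V * ∫ ω, S.power (y t ω) ∂μ := fun {y} hy => by
    have h1 : ∀ i, Integrable
        (fun ω => S.queue s x t ω i * S.departure (State.h (s t ω)) (y t ω) i) μ := fun i =>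
      (memLp_queue hν hs hpol t i).integrable_mul (memLp_departure_policy hν hs hy t i)
    have h2 : Integrable (fun ω =>
        -(∑ i, S.queue s x t ω i * S.departure (State.h (s t ω)) (y t ω) i)) μ :=
      (integrable_finsetSum _ fun i _ => h1 i).neg
    have h3 := (integrable_power_policy hy t).const_mul V
    refine ⟨h2.add h3, ?_⟩
    unfold perSlotObjective
    rw [integral_add h2 h3, integral_neg, integral_finsetSum _ fun i _ => h1 i,
      integral_const_mul]
  have hmin : ∫ ω, S.perSlotObjective V (S.queue s x t ω) (State.h (s t ω)) (x t ω) ∂μ ≤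
      ∫ ω, S.perSlotObjective V (S.queue s x t ω) (State.h (s t ω)) (F (s t ω)) ∂μ := by
    refine integral_mono_ae (hobj hpol).1 (hobj hFpol).1 ?_
    filter_upwards [hx.isMinOn t, hFpol.mem t] with ω h1 h2 using h1 h2
  rw [(hobj hpol).2, (hobj hFpol).2, hs.integral_comp (g := fun z => S.power (F z))
    (S.continuous_power.measurable.comp hF)] at hmin
  have hF' : ∑ i, (∫ ω, S.queue s x t ω i ∂μ) * r.1 i ≤
      ∑ i, ∫ ω, S.queue s x t ω i * S.departure (State.h (s t ω)) (F (s t ω)) i ∂μ :=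
    Finset.sum_le_sum fun i _ => by
      rw [integral_queue_mul hs hpol t i (g := fun z => S.departure (State.h z) (F z) i)
        ((S.measurable_departure i).comp (measurable_id.prodMk hF))]
      exact mul_le_mul_of_nonneg_left (hFd i) (integral_queue_nonneg hν hs hpol t i)
  have hdrift := Finset.sum_le_sum (s := Finset.univ) fun i _ =>
    integral_sq_queue_succ_le hν hs hpol t i
  simp only [Finset.sum_add_distrib, Finset.sum_sub_distrib, ← Finset.mul_sum] at hdrift
  have hp := mul_le_mul_of_nonneg_left hFp hV
  simp only [driftConst, mul_sub, Finset.sum_sub_distrib, Finset.sum_add_distrib]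
  linarith

/-- Summation of a one-slot bound with constant right-hand side. -/
theorem sum_le_of_drift_le {L p q : ℕ → ℝ} {V c ε : ℝ} (h0 : L 0 = 0)
    (h : ∀ t, L (t + 1) + V * p t + ε * q t ≤ L t + c) (T : ℕ) :
    L T + V * ∑ t ∈ Finset.range T, p t + ε * ∑ t ∈ Finset.range T, q t ≤ c * T := by
  induction T with
  | zero => simp [h0]
  | succ T ih =>
    rw [Finset.sum_range_succ, Finset.sum_range_succ]
    push_cast
    linarith [h T]

/-- The one-slot bound against a feasible policy: its averages up to slot `T` are attainable, and
the deficit of departures vanishes as `T → ∞`, with the queue lengths of the run held fixed. -/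
theorem IsOnlineRun.drift_le_avgPower {V : ℝ} (hV : 0 < V) (hν : S.IsStateLaw ν)
    (hs : IsStateProcess μ ν 𝒢 s) (hx : S.IsOnlineRun V μ 𝒢 s x)
    (hy : S.IsFeasiblePolicy μ 𝒢 s y) (t : ℕ) :
    (1 / 2) * (∑ i, ∫ ω, S.queue s x (t + 1) ω i ^ 2 ∂μ) + V * ∫ ω, S.power (x t ω) ∂μ ≤
      (1 / 2) * (∑ i, ∫ ω, S.queue s x t ω i ^ 2 ∂μ) +
        (S.driftConst ν + V * S.avgPower μ y) := by
  refine le_of_forall_pos_le_add fun δ hδ => ?_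
  have hlim : Tendsto (fun T : ℕ => (1 / 2) * (∑ i, ∫ ω, S.queue s x t ω i ^ 2 ∂μ) +
      S.driftConst ν + (∑ i, (∫ ω, S.queue s x t ω i ∂μ) *
        ((∫ ω, |S.queue s y T ω i| ∂μ) / T)) + V * (S.avgPower μ y + δ / V)) atTop
      (𝓝 ((1 / 2) * (∑ i, ∫ ω, S.queue s x t ω i ^ 2 ∂μ) + S.driftConst ν +
        (∑ i, (∫ ω, S.queue s x t ω i ∂μ) * 0) + V * (S.avgPower μ y + δ / V))) :=
    (tendsto_const_nhds.add (tendsto_finsetSum _ fun i _ =>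
      (hy.stable i).const_mul _)).add_const _
  have hlt : ∀ᶠ T : ℕ in atTop,
      1 / (T : ℝ) * ∫ ω, ∑ t ∈ Finset.range T, S.power (y t ω) ∂μ < S.avgPower μ y + δ / V :=
    eventually_lt_of_limsup_lt (lt_add_of_pos_right _ (div_pos hδ hV))
      (isBoundedUnder_average_power hy.toIsPolicy)
  refine (ge_of_tendsto hlim ?_).trans (le_of_eq ?_)
  · filter_upwards [hlt, eventually_gt_atTop 0] with T hT hT0
    have h := hx.drift_le hV.le hν hs (average_mem_attainable hν hs hy.toIsPolicy hT0) t
    simp only [sub_sub_cancel] at h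
    exact h.trans (by gcongr)
  · simp only [mul_zero, Finset.sum_const_zero, add_zero]
    field_simp
    ring

theorem IsOnlineRun.sum_drift_le {V : ℝ} (hV : 0 < V) (hν : S.IsStateLaw ν)
    (hs : IsStateProcess μ ν 𝒢 s) (hx : S.IsOnlineRun V μ 𝒢 s x)
    (hy : S.IsFeasiblePolicy μ 𝒢 s y) (T : ℕ) :
    (1 / 2) * (∑ i, ∫ ω, S.queue s x T ω i ^ 2 ∂μ) +
      V * ∑ t ∈ Finset.range T, ∫ ω, S.power (x t ω) ∂μ ≤
      (S.driftConst ν + V * S.avgPower μ y) * T := by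
  have h := sum_le_of_drift_le (ε := 0) (q := fun _ => 0)
    (L := fun T => (1 / 2) * (∑ i, ∫ ω, S.queue s x T ω i ^ 2 ∂μ))
    (p := fun t => ∫ ω, S.power (x t ω) ∂μ)
    (by simp [queue]) (fun t => by simpa using hx.drift_le_avgPower hV hν hs hy t) T
  simpa using h

theorem IsOnlineRun.meanRateStable {V : ℝ} (hV : 0 < V) (hν : S.IsStateLaw ν)
    (hs : IsStateProcess μ ν 𝒢 s) (hx : S.IsOnlineRun V μ 𝒢 s x)
    (hy : S.IsFeasiblePolicy μ 𝒢 s y) (i : Fin N) : S.MeanRateStable μ s x i := by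
  refine meanRateStable_of_integral_sq_le hν hs hx.toIsPolicy i
    (c := 2 * (S.driftConst ν + V * S.avgPower μ y)) fun T => ?_
  have h := hx.sum_drift_le hV hν hs hy T
  have h1 : 0 ≤ V * ∑ t ∈ Finset.range T, ∫ ω, S.power (x t ω) ∂μ :=
    mul_nonneg hV.le (Finset.sum_nonneg fun t _ => integral_power_policy_nonneg hx.toIsPolicy t)
  have h2 := Finset.single_le_sum (f := fun i => ∫ ω, S.queue s x T ω i ^ 2 ∂μ)
    (fun j _ => integral_nonneg fun ω => sq_nonneg _) (Finset.mem_univ i)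
  linarith

theorem IsOnlineRun.avgPower_le_avgPower {V : ℝ} (hV : 0 < V) (hν : S.IsStateLaw ν)
    (hs : IsStateProcess μ ν 𝒢 s) (hx : S.IsOnlineRun V μ 𝒢 s x)
    (hy : S.IsFeasiblePolicy μ 𝒢 s y) :
    S.avgPower μ x ≤ S.avgPower μ y + S.driftConst ν / V := by
  refine limsup_le_of_le (isCoboundedUnder_average_power hx.toIsPolicy) ?_
  filter_upwards [eventually_gt_atTop 0] with T hT
  have hT' : (0 : ℝ) < T := Nat.cast_pos.2 hT
  have h := hx.sum_drift_le hV hν hs hy T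
  have h0 := half_sum_integral_sq_nonneg (S := S) (μ := μ) (s := s) (x := x) T
  have e : V * (T * (S.avgPower μ y + S.driftConst ν / V)) =
      (S.driftConst ν + V * S.avgPower μ y) * T := by
    field_simp
    ring
  rw [integral_sum_power hx.toIsPolicy, one_div, inv_mul_le_iff₀ hT']
  refine le_of_mul_le_mul_left ?_ hV
  linarith

/-- Against the Slater policy the drift bound keeps the term `ε ∑ᵢ 𝔼 Qᵢ(t)`. -/
theorem IsOnlineRun.average_queue_le {V : ℝ} (hV : 0 < V) (hν : S.IsStateLaw ν)
    (hs : IsStateProcess μ ν 𝒢 s) (hx : S.IsOnlineRun V μ 𝒢 s x) {ε Ψ : ℝ} (hε : 0 < ε)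
    (hΨ : S.Slater ν ε Ψ) {T : ℕ} (hT : 0 < T) :
    1 / (T : ℝ) * ∫ ω, ∑ t ∈ Finset.range T, ∑ i, S.queue s x t ω i ∂μ ≤
      (S.driftConst ν + V * Ψ -
        V * (1 / (T : ℝ) * ∫ ω, ∑ t ∈ Finset.range T, S.power (x t ω) ∂μ)) / ε := by
  have hT' : (0 : ℝ) < T := Nat.cast_pos.2 hT
  have hpol := hx.toIsPolicy
  have hQ : ∀ t i, Integrable (fun ω => S.queue s x t ω i) μ := fun t i =>
    (memLp_queue hν hs hpol t i).integrable one_le_two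
  have h := sum_le_of_drift_le (ε := ε) (V := V) (c := S.driftConst ν + V * Ψ)
    (L := fun T => (1 / 2) * (∑ i, ∫ ω, S.queue s x T ω i ^ 2 ∂μ))
    (p := fun t => ∫ ω, S.power (x t ω) ∂μ)
    (q := fun t => ∑ i, ∫ ω, S.queue s x t ω i ∂μ) (by simp [queue])
    (fun t => by
      have h := hx.drift_le hV.le hν hs (mem_attainable_of_slater hν hΨ) t
      simp only [sub_add_cancel_left, mul_neg, Finset.sum_neg_distrib, ← Finset.sum_mul] at h
      linarith) T
  have h0 := half_sum_integral_sq_nonneg (S := S) (μ := μ) (s := s) (x := x) T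
  rw [integral_sum_power hpol, integral_finsetSum _ fun t _ => integrable_finsetSum _
    fun i _ => hQ t i]
  simp_rw [integral_finsetSum _ fun i (_ : i ∈ Finset.univ) => hQ _ i]
  have e : (T : ℝ) * ((S.driftConst ν + V * Ψ -
      V * (1 / (T : ℝ) * ∑ t ∈ Finset.range T, ∫ ω, S.power (x t ω) ∂μ)) / ε) =
      ((S.driftConst ν + V * Ψ) * T - V * ∑ t ∈ Finset.range T, ∫ ω, S.power (x t ω) ∂μ) / ε := by
    field_simp
  rw [one_div, inv_mul_le_iff₀ hT', ← one_div, e, le_div_iff₀ hε]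
  linarith

theorem IsOnlineRun.avgSumQueue_le {V : ℝ} (hV : 0 < V) (hν : S.IsStateLaw ν)
    (hs : IsStateProcess μ ν 𝒢 s) (hx : S.IsOnlineRun V μ 𝒢 s x)
    (hstable : ∀ i, S.MeanRateStable μ s x i) {ε Ψ : ℝ} (hε : 0 < ε) (hΨ : S.Slater ν ε Ψ) :
    S.avgSumQueue μ s x ≤
      (((S.driftConst ν + V * (Ψ - S.optPower μ 𝒢 s)) / ε : ℝ) : EReal) := by
  refine EReal.le_of_forall_lt_iff_le.1 fun c hc => ?_
  have hc' := EReal.coe_lt_coe_iff.1 hc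
  rw [div_lt_iff₀ hε] at hc'
  refine limsup_le_of_le (h := ?_)
  -- The slack between `c` and the claimed bound, in units of power.
  have hδ : 0 < (c * ε - (S.driftConst ν + V * (Ψ - S.optPower μ 𝒢 s))) / V :=
    div_pos (sub_pos.2 hc') hV
  filter_upwards [eventually_optPower_sub_le hν hs ⟨hx.toIsPolicy, hstable⟩ hε hΨ hδ,
    eventually_gt_atTop 0] with T hT hT0
  refine EReal.coe_le_coe_iff.2 ((hx.average_queue_le hV hν hs hε hΨ hT0).trans ?_)
  rw [div_le_iff₀ hε]
  have h := mul_le_mul_of_nonneg_left hT hV.le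
  rw [mul_sub, mul_div_cancel₀ _ hV.ne'] at h
  linarith

end Optimum

end System

end MEC

theorem theorem1 {N : ℕ} (S : MEC.System N)
    (ν : MeasureTheory.Measure (MEC.State N)) (hν : S.IsStateLaw ν)
    {Ω : Type*} [m : MeasurableSpace Ω] (μ : MeasureTheory.Measure Ω)
    [MeasureTheory.IsProbabilityMeasure μ] (𝒢 : MeasureTheory.Filtration ℕ m)
    (s : ℕ → Ω → MEC.State N) (hs : MEC.System.IsStateProcess μ ν 𝒢 s)
    (hfeas : ∃ x, S.IsFeasiblePolicy μ 𝒢 s x) :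
    (∀ V : ℝ, 0 < V → ∀ x : ℕ → Ω → MEC.Action N, S.IsOnlineRun V μ 𝒢 s x →
      S.avgPower μ x ≤ S.optPower μ 𝒢 s + S.driftConst ν / V ∧
      (∀ i, S.MeanRateStable μ s x i) ∧
      (∀ ε Ψ : ℝ, 0 < ε → S.Slater ν ε Ψ →
        S.avgSumQueue μ s x ≤
          (((S.driftConst ν + V * (Ψ - S.optPower μ 𝒢 s)) / ε : ℝ) : EReal))) ∧
    (∀ ε Ψ : ℝ, 0 < ε → S.Slater ν ε Ψ →
      ∃ K : ℝ, ∀ V : ℝ, 1 ≤ V → ∀ x : ℕ → Ω → MEC.Action N, S.IsOnlineRun V μ 𝒢 s x →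
        S.optPower μ 𝒢 s ≤ S.avgPower μ x ∧
        S.avgPower μ x ≤ S.optPower μ 𝒢 s + K / V ∧
        S.avgSumQueue μ s x ≤ ((K * V : ℝ) : EReal)) := by
  obtain ⟨y₀, hy₀⟩ := hfeas
  have main : ∀ V : ℝ, 0 < V → ∀ x : ℕ → Ω → MEC.Action N, S.IsOnlineRun V μ 𝒢 s x →
      S.avgPower μ x ≤ S.optPower μ 𝒢 s + S.driftConst ν / V ∧
      (∀ i, S.MeanRateStable μ s x i) ∧
      (∀ ε Ψ : ℝ, 0 < ε → S.Slater ν ε Ψ →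
        S.avgSumQueue μ s x ≤
          (((S.driftConst ν + V * (Ψ - S.optPower μ 𝒢 s)) / ε : ℝ) : EReal)) := by
    intro V hV x hx
    have hstable := hx.meanRateStable hV hν hs hy₀
    refine ⟨?_, hstable, fun ε Ψ hε hΨ => hx.avgSumQueue_le hV hν hs hstable hε hΨ⟩
    rw [← sub_le_iff_le_add]
    refine le_csInf ⟨_, y₀, hy₀, rfl⟩ ?_
    rintro _ ⟨y, hy, rfl⟩
    exact sub_le_iff_le_add.2 (hx.avgPower_le_avgPower hV hν hs hy)
  refine ⟨main, fun ε Ψ hε hΨ => ?_⟩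
  refine ⟨max (S.driftConst ν) ((S.driftConst ν + |Ψ - S.optPower μ 𝒢 s|) / ε),
    fun V hV1 x hx => ?_⟩
  have hV : 0 < V := one_pos.trans_le hV1
  obtain ⟨hP, hstable, hQ⟩ := main V hV x hx
  refine ⟨MEC.System.optPower_le_avgPower ⟨hx.toIsPolicy, hstable⟩, hP.trans ?_,
    (hQ ε Ψ hε hΨ).trans (EReal.coe_le_coe_iff.2 ?_)⟩
  · gcongr
    exact le_max_left _ _
  · refine le_trans ?_ (mul_le_mul_of_nonneg_right (le_max_right _ _) hV.le)
    rw [div_mul_eq_mul_div, div_le_div_iff_of_pos_right hε]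
    have h1 := mul_le_mul_of_nonneg_left (le_abs_self (Ψ - S.optPower μ 𝒢 s)) hV.le
    have h2 := mul_le_mul_of_nonneg_left hV1 (S.driftConst_nonneg ν)
    linarith
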